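/- **Setting.** A base station reaches a ground node through a route of $L\ge 2$ reconfigurable surfaces; the $i$-th surface has $N_i\ge 1$ elements. Let $P_t>0$ be the transmit power, $\sigma^2>0$ the noise power, $G=G_tG_r>0$ the product of the antenna gains ($G_t,G_r>0$), and $l_c=\prod_{i=1}^{L+1}C_0\,(d_i/d_0)^{-n_i}$ the path loss of the route, with $C_0,d_0,d_i>0$ and $n_i\in\mathbb R$. For $k\in\{1,L\}$ let $m_k,\Omega_k>0$ be the Nakagami fading parameters and $\kappa_k\ge 0$ the concentration of the von Mises phase error at the $k$-th surface, and put $$\bar\Omega_k=t_{1,k}^2\left(\frac{\Gamma(m_k+\frac12)}{\Gamma(m_k)}\sqrt{\frac{\Omega_k}{m_k}}\right)^2,\qquad \bar m_k=\frac{N_k\bar\Omega_k}{2+2t_{2,k}-4\bar\Omega_k},\qquad t_{n,k}=\frac{I_n(\kappa_k)}{I_0(\kappa_k)},$$ where $I_n$ is the modified Bessel function of the first kind. Assume $\bar m_1,\bar m_L>0$ (so that the following Nakagami laws are defined). Let $Z_1,Z_L$ be independent random variables, $Z_k$ having the Nakagami distribution with shape $\bar m_k$ and spread $\bar\Omega_k$,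 i.e. the density $\frac{2\bar m_k^{\bar m_k}}{\Gamma(\bar m_k)\bar\Omega_k^{\bar m_k}}x^{2\bar m_k-1}e^{-\bar m_kx^2/\bar\Omega_k}$ on $x>0$. The channel amplitude is replaced by its double-Nakagami approximation $|H_c|=\left(\prod_{i=1}^{L}N_i\right)Z_1Z_L$, so that the received signal-to-noise ratio is $\gamma_r=\frac{P_t}{\sigma^2}l_cG\,|H_c|^2$. **Proposition.** In this approximation $|H_c|$ has a probability density $f_{|H_c|}$, the ergodic capacity $$C_c=\int_0^\infty\log_2\!\left(1+\frac{P_t}{\sigma^2}\,l_c\,G\,x^2\right)f_{|H_c|}(x)\,dx$$ is finite (the integral converges), and $$C_c=\frac{1}{\ln 2\;\Gamma(\bar m_1)\Gamma(\bar m_L)}\;G^{1,4}_{4,2}\!\left(\frac{P_t\,G\,l_c\prod_{i=1}^{L}N_i^2}{\sigma^2\,\frac{\bar m_1\bar m_L}{\bar\Omega_1\bar\Omega_L}}\;\middle|\;\begin{array}{c}1,\,1,\,1-\bar m_1,\,1-\bar m_L\\ 1,\,0\end{array}\right).$$ Here $G^{m,n}_{p,q}$ is the Meijer $G$-function, given by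 the Mellin–Barnes integral $$G^{m,n}_{p,q}\!\left(z\,\middle|\begin{array}{c}a_1,\dots,a_p\\ b_1,\dots,b_q\end{array}\right)=\frac1{2\pi i}\int_{c-i\infty}^{c+i\infty}\frac{\prod_{j\le m}\Gamma(b_j-s)\prod_{j\le n}\Gamma(1-a_j+s)}{\prod_{j>m}\Gamma(1-b_j+s)\prod_{j>n}\Gamma(a_j-s)}\,z^s\,ds$$ along a vertical line separating the poles of the $\Gamma(b_j-s)$, $j\le m$ (on its right), from those of the $\Gamma(1-a_j+s)$, $j\le n$ (on its left); for the parameters above such lines exist and the integral converges absolutely along each of them. -/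

import Mathlib

open MeasureTheory ProbabilityTheory

noncomputable section

namespace CascadedRIS

/-! ### The Meijer G-function -/

/-- The Mellin-Barnes integrand of the Meijer function `G^{m,n}_{p,q}(z | a; b)`:
the product of `Γ(b_j - s)` over the first `m` of the `b_j` and of `Γ(1 - a_j + s)` over the first
`n` of the `a_j`, divided by the product of `Γ(1 - b_j + s)` over the remaining `b_j` and of
`Γ(a_j - s)` over the remaining `a_j`, times `z ^ s`. (At a pole of a Gamma factor in the
denominator the quotient is `0`, which is the value of the entire function `1 / Γ`.) -/
def meijerGIntegrand (m n : ℕ) {p q : ℕ} (a : Fin p → ℂ) (b : Fin q → ℂ) (z s : ℂ) : ℂ :=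
  ((∏ j : Fin q with j.val < m, Complex.Gamma (b j - s)) *
      ∏ j : Fin p with j.val < n, Complex.Gamma (1 - a j + s)) /
    ((∏ j : Fin q with m ≤ j.val, Complex.Gamma (1 - b j + s)) *
      ∏ j : Fin p with n ≤ j.val, Complex.Gamma (a j - s)) * z ^ s

/-- The upward vertical line `Re s = c` separates the poles `a_j - 1 - k` of the factors
`Γ(1 - a_j + s)`, which lie to its left, from the poles `b_j + k` of the factors `Γ(b_j - s)`,
which lie to its right (`k = 0, 1, 2, …`). -/
def IsSeparating (m n : ℕ) {p q : ℕ} (a : Fin p → ℂ) (b : Fin q → ℂ) (c : ℝ) : Prop :=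
  (∀ j : Fin p, j.val < n → ∀ k : ℕ, (a j - 1 - k).re < c) ∧
    ∀ j : Fin q, j.val < m → ∀ k : ℕ, c < (b j + k).re

/-- `(1 / 2πi) ∫_{c - i∞}^{c + i∞}` of the Mellin-Barnes integrand, with `s = c + i y`,
`ds = i dy`. -/
def mellinBarnesIntegral (m n : ℕ) {p q : ℕ} (a : Fin p → ℂ) (b : Fin q → ℂ) (z : ℂ) (c : ℝ) : ℂ :=
  1 / (2 * (Real.pi : ℂ) * Complex.I) *
    ∫ y : ℝ, meijerGIntegrand m n a b z ((c : ℂ) + (y : ℂ) * Complex.I) * Complex.I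

/-- The Mellin-Barnes representation of `G^{m,n}_{p,q}(z | a; b)` over vertical lines is
meaningful: there is a vertical line that separates the two families of poles, and along every such
line the integral converges absolutely. -/
def MeijerGConverges (m n : ℕ) {p q : ℕ} (a : Fin p → ℂ) (b : Fin q → ℂ) (z : ℂ) : Prop :=
  (∃ c : ℝ, IsSeparating m n a b c) ∧
    ∀ c : ℝ, IsSeparating m n a b c →
      Integrable (fun y : ℝ => meijerGIntegrand m n a b z ((c : ℂ) + (y : ℂ) * Complex.I))

open Classical in
/-- The Meijer function `G^{m,n}_{p,q}(z | a; b)`, as the Mellin-Barnes integral along a vertical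
line that separates the two families of poles. -/
def meijerG (m n : ℕ) {p q : ℕ} (a : Fin p → ℂ) (b : Fin q → ℂ) (z : ℂ) : ℂ :=
  if h : ∃ c : ℝ, IsSeparating m n a b c then mellinBarnesIntegral m n a b z h.choose else 0

/-! ### The Nakagami distribution -/

/-- Density of the Nakagami distribution with shape `m` and spread `w`. -/
def nakagamiPDFReal (m w x : ℝ) : ℝ :=
  if 0 < x then
    2 * m ^ m / (Real.Gamma m * w ^ m) * x ^ (2 * m - 1) * Real.exp (-(m / w) * x ^ 2)
  else 0

/-- The Nakagami distribution with shape `m` and spread `w` (for `m, w > 0`). -/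
def nakagamiMeasure (m w : ℝ) : Measure ℝ :=
  volume.withDensity fun x => ENNReal.ofReal (nakagamiPDFReal m w x)

/-! ### Parameters of the cascaded channel -/

/-- The modified Bessel function of the first kind of integer order `n`. -/
def besselI (n : ℕ) (x : ℝ) : ℝ :=
  1 / Real.pi * ∫ θ in (0 : ℝ)..Real.pi, Real.exp (x * Real.cos θ) * Real.cos (n * θ)

/-- The `n`-th trigonometric moment of the von Mises distribution with mean direction `0` and
concentration `κ`. -/
def trigMoment (n : ℕ) (κ : ℝ) : ℝ := besselI n κ / besselI 0 κ

/-- The spread parameter of the approximating Nakagami variable, from the shape `m` and spread `w`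
of the fading and the concentration `κ` of the phase error. -/
def spreadBar (m w κ : ℝ) : ℝ :=
  trigMoment 1 κ ^ 2 * (Real.Gamma (m + 1 / 2) / Real.Gamma m * √(w / m)) ^ 2

/-- The shape parameter of the approximating Nakagami variable of a surface with `N` elements. -/
def shapeBar (N : ℕ) (m w κ : ℝ) : ℝ :=
  N * spreadBar m w κ / (2 + 2 * trigMoment 2 κ - 4 * spreadBar m w κ)

/-- Total path loss of a route with `L` surfaces, hence `L + 1` links. -/
def pathLoss (L : ℕ) (C₀ d₀ : ℝ) (d e : ℕ → ℝ) : ℝ :=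
  ∏ i ∈ Finset.Icc 1 (L + 1), C₀ * (d i / d₀) ^ (-e i)

/-- The approximated channel amplitude `(∏_{i=1}^L N_i) Z₁ Z_L`. -/
def channelAmplitude {S : Type*} (L : ℕ) (N : ℕ → ℕ) (Z₁ Z_L : S → ℝ) (s : S) : ℝ :=
  (∏ i ∈ Finset.Icc 1 L, (N i : ℝ)) * Z₁ s * Z_L s

/-- The ergodic capacity `∫_0^∞ log₂ (1 + ρ x²) f(x) dx`, where `f` is the probability density
function of the channel amplitude `H` and `ρ x²` is the instantaneous received signal-to-noise ratio
at amplitude `x`. -/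
def ergodicCapacity {S : Type*} [MeasurableSpace S] (P : Measure S) (H : S → ℝ) (ρ : ℝ) : ℝ :=
  ∫ x in Set.Ioi (0 : ℝ), Real.logb 2 (1 + ρ * x ^ 2) * (pdf H P volume x).toReal

end CascadedRIS

end

namespace CascadedRIS

open Set Filter

/-! The capacity is `E log (1 + X) / log 2` with `X = A Z₁² Z_L²`, so it is enough to expand the
logarithm in powers `X ^ s` and use the moments of `X`. On any line `Re s = c`, `0 < c < 1`, `log (1
+ x)` is the Mellin–Barnes integral of `Γ(s) Γ(1 - s) / s * x ^ s` (`log_one_add_eq_mellinBarnes`).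
This comes from Mellin inversion for `1 / (1 + x)`, integrated through `log (1 + x) = ∫₀¹ x / (1 + u
x) du`. Fubini moves the expectation inside (`integral_log_one_add`). By independence `E X ^ s` is a
product of two Nakagami moments, each a ratio of Gamma values times a power. Since `Γ(s) / s = Γ(s)²
/ Γ(1 + s)`, the result is exactly the Meijer integrand, and the separating lines are exactly those
with `0 < c < 1`. Absolute convergence rests on the `1 / (1 + y²)` decay of `Γ(s) Γ(1 - s)`; the
moment factors are bounded on the line. -/

/-! ### Gamma on vertical lines and Mellin inversion for `1 / (1 + x)` -/

theorem norm_Gamma_le {s : ℂ} (hs : 0 < s.re) : ‖Complex.Gamma s‖ ≤ Real.Gamma s.re := by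
  rw [Complex.Gamma_eq_integral hs, Real.Gamma_eq_integral hs, Complex.GammaIntegral]
  refine (norm_integral_le_integral_norm _).trans_eq ?_
  refine setIntegral_congr_fun measurableSet_Ioi fun x hx => ?_
  simp only [norm_mul, Complex.norm_real, Complex.norm_cpow_eq_rpow_re_of_pos hx,
    Complex.sub_re, Complex.one_re, Real.norm_eq_abs, Real.abs_exp]

/-- Justifies Fubini after writing `1 / (1 + x) = ∫ exp (-(1 + x) t) dt`. Integrating the norm over
`x` first leaves `Γ(σ) exp (-t) t ^ (-σ)` with `σ = Re s`: `σ > 0` is needed for the inner integral,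
`σ < 1` for the outer one. -/
theorem integrable_cpow_mul_exp_prod {s : ℂ} (h0 : 0 < s.re) (h1 : s.re < 1) :
    Integrable (fun p : ℝ × ℝ => (p.1 : ℂ) ^ (s - 1) * (Real.exp (-((1 + p.1) * p.2)) : ℝ))
      ((volume.restrict (Ioi 0)).prod (volume.restrict (Ioi 0))) := by
  have hnorm : ∀ x : ℝ, 0 < x → ∀ t : ℝ,
      ‖(x : ℂ) ^ (s - 1) * (Real.exp (-((1 + x) * t)) : ℝ)‖ =
        Real.exp (-t) * (x ^ (s.re - 1) * Real.exp (-(t * x))) := by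
    intro x hx t
    rw [norm_mul, Complex.norm_real, Complex.norm_cpow_eq_rpow_re_of_pos hx, Real.norm_eq_abs,
      Real.abs_exp, show -((1 + x) * t) = -t + -(t * x) by ring, Real.exp_add]
    simp only [Complex.sub_re, Complex.one_re]
    ring
  have hreal : ∀ t : ℝ, 0 < t →
      IntegrableOn (fun x : ℝ => x ^ (s.re - 1) * Real.exp (-(t * x))) (Ioi 0) := by
    intro t ht
    have := integrableOn_rpow_mul_exp_neg_mul_rpow (s := s.re - 1) (p := 1) (b := t)
      (by linarith) one_pos ht
    simpa [neg_mul] using this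
  have hmeas : Measurable
      (fun p : ℝ × ℝ => (p.1 : ℂ) ^ (s - 1) * (Real.exp (-((1 + p.1) * p.2)) : ℝ)) := by
    fun_prop
  rw [integrable_prod_iff' hmeas.aestronglyMeasurable]
  constructor
  · filter_upwards [ae_restrict_mem measurableSet_Ioi] with t ht
    refine ((hreal t ht).const_mul (Real.exp (-t))).mono' ?_ ?_
    · exact (hmeas.comp (measurable_id.prodMk measurable_const)).aestronglyMeasurable
    · filter_upwards [ae_restrict_mem measurableSet_Ioi] with x hx
      exact (hnorm x hx t).le
  · have hG := Real.GammaIntegral_convergent (s := 1 - s.re) (by linarith)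
    refine (hG.mul_const (Real.Gamma s.re)).congr ?_
    filter_upwards [ae_restrict_mem measurableSet_Ioi] with t ht
    rw [setIntegral_congr_fun measurableSet_Ioi (fun x hx => hnorm x hx t),
      integral_const_mul, Real.integral_rpow_mul_exp_neg_mul_Ioi h0 ht, one_div,
      Real.inv_rpow (le_of_lt ht), ← Real.rpow_neg (le_of_lt ht)]
    rw [show 1 - s.re - 1 = -s.re by ring]
    ring

theorem integral_exp_neg_mul_Ioi {a : ℝ} (ha : 0 < a) :
    ∫ t in Ioi (0 : ℝ), Real.exp (-(a * t)) = a⁻¹ := by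
  have := Real.integral_rpow_mul_exp_neg_mul_Ioi (a := 1) (r := a) one_pos ha
  simpa using this

theorem integral_cpow_mul_exp_right {s : ℂ} {x : ℝ} (hx : 0 < x) :
    ∫ t in Ioi (0 : ℝ), (x : ℂ) ^ (s - 1) * (Real.exp (-((1 + x) * t)) : ℝ) =
      (x : ℂ) ^ (s - 1) * ((1 + x)⁻¹ : ℝ) := by
  rw [integral_const_mul, integral_complex_ofReal, integral_exp_neg_mul_Ioi (by linarith)]

theorem mellinConvergent_inv_one_add {s : ℂ} (h0 : 0 < s.re) (h1 : s.re < 1) :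
    MellinConvergent (fun x : ℝ => (((1 + x)⁻¹ : ℝ) : ℂ)) s := by
  refine (integrable_cpow_mul_exp_prod h0 h1).integral_prod_left.congr ?_
  filter_upwards [ae_restrict_mem measurableSet_Ioi] with x hx
  exact integral_cpow_mul_exp_right hx

theorem mellin_inv_one_add {s : ℂ} (h0 : 0 < s.re) (h1 : s.re < 1) :
    mellin (fun x : ℝ => (((1 + x)⁻¹ : ℝ) : ℂ)) s = Complex.Gamma s * Complex.Gamma (1 - s) := by
  have hswap := integral_integral_swap (f := fun x t : ℝ =>
    (x : ℂ) ^ (s - 1) * (Real.exp (-((1 + x) * t)) : ℝ)) (integrable_cpow_mul_exp_prod h0 h1)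
  have hl : mellin (fun x : ℝ => (((1 + x)⁻¹ : ℝ) : ℂ)) s =
      ∫ x in Ioi (0 : ℝ), ∫ t in Ioi (0 : ℝ),
        (x : ℂ) ^ (s - 1) * (Real.exp (-((1 + x) * t)) : ℝ) :=
    setIntegral_congr_fun measurableSet_Ioi fun x hx => (integral_cpow_mul_exp_right hx).symm
  rw [hl, hswap, Complex.Gamma_eq_integral (s := 1 - s) (by simpa using h1),
    Complex.GammaIntegral, ← integral_const_mul]
  refine setIntegral_congr_fun measurableSet_Ioi fun t ht => ?_
  have hc : ∀ x ∈ Ioi (0 : ℝ), (x : ℂ) ^ (s - 1) * (Real.exp (-((1 + x) * t)) : ℝ) =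
      (Real.exp (-t) : ℂ) * ((x : ℂ) ^ (s - 1) * Complex.exp (-(t * x))) := by
    intro x _
    rw [show -((1 + x) * t) = -t + -(t * x) by ring, Real.exp_add]
    push_cast
    ring
  rw [setIntegral_congr_fun measurableSet_Ioi hc, integral_const_mul,
    Complex.integral_cpow_mul_exp_neg_mul_Ioi h0 ht, one_div, ← Complex.ofReal_inv,
    Complex.ofReal_inv, Complex.inv_cpow _ _ (by
      rw [Complex.arg_ofReal_of_nonneg (le_of_lt ht)]; exact Real.pi_pos.ne),
    ← Complex.cpow_neg, show 1 - s - 1 = -s by ring]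
  push_cast
  ring

/-- On the line `Re s = c` with `0 < c < 1`, the product `Γ(s) Γ(1 - s)` decays at least like
`1 / |s|²`. -/
theorem norm_Gamma_mul_Gamma_one_sub_le {c : ℝ} (h0 : 0 < c) (h1 : c < 1) (y : ℝ) :
    ‖Complex.Gamma (c + y * Complex.I) * Complex.Gamma (1 - (c + y * Complex.I))‖ ≤
      Real.Gamma (c + 1) * Real.Gamma (1 - c + 1) / (c * (1 - c)) * (1 + y ^ 2)⁻¹ := by
  -- Bounding Gamma by its value at the real part gives no decay. Using `Γ(s) = Γ(s + 1) / s` first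
  -- gains `1 / |s|` per factor, and `|d + i t| ≥ d √(1 + t²)` because `d < 1`.
  have key : ∀ (d : ℝ), 0 < d → d < 1 → ∀ t : ℝ,
      ‖Complex.Gamma (d + t * Complex.I)‖ ≤ Real.Gamma (d + 1) / (d * √(1 + t ^ 2)) := by
    intro d hd0 hd1 t
    have hne : (d + t * Complex.I : ℂ) ≠ 0 := by
      intro h
      have := congrArg Complex.re h
      simp at this
      linarith
    have hG := norm_Gamma_le (s := (d + t * Complex.I : ℂ) + 1) (by simp; linarith)
    rw [Complex.Gamma_add_one _ hne, norm_mul] at hG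
    have hre : ((d + t * Complex.I : ℂ) + 1).re = d + 1 := by simp
    rw [hre] at hG
    have hn : d * √(1 + t ^ 2) ≤ ‖(d + t * Complex.I : ℂ)‖ := by
      rw [Complex.norm_add_mul_I]
      refine Real.le_sqrt_of_sq_le ?_
      rw [mul_pow, Real.sq_sqrt (by positivity)]
      nlinarith [sq_nonneg t, mul_nonneg (sq_nonneg t) (by nlinarith : 0 ≤ 1 - d ^ 2)]
    rw [le_div_iff₀ (by positivity)]
    calc _ ≤ ‖Complex.Gamma (d + t * Complex.I)‖ * ‖(d + t * Complex.I : ℂ)‖ := by gcongr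
      _ ≤ _ := by rwa [mul_comm]
  have e : (1 - (c + y * Complex.I) : ℂ) = ((1 - c : ℝ) : ℂ) + ((-y : ℝ) : ℂ) * Complex.I := by
    push_cast; ring
  rw [norm_mul, e]
  have k1 := key c h0 h1 y
  have k2 := key (1 - c) (by linarith) (by linarith) (-y)
  refine (mul_le_mul k1 k2 (norm_nonneg _) ((norm_nonneg _).trans k1)).trans_eq ?_
  have hs : √(1 + y ^ 2) * √(1 + y ^ 2) = 1 + y ^ 2 := Real.mul_self_sqrt (by positivity)
  rw [neg_sq, div_mul_div_comm, mul_mul_mul_comm, hs, ← div_div, div_eq_mul_inv _ (1 + y ^ 2)]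

theorem Gamma_line_ne_zero {c : ℝ} (h0 : 0 < c) (y : ℝ) : (c + y * Complex.I : ℂ) ≠ 0 := by
  intro h
  have := congrArg Complex.re h
  simp at this
  linarith

theorem continuous_Gamma_line {c : ℝ} (h0 : 0 < c) :
    Continuous fun y : ℝ => Complex.Gamma (c + y * Complex.I) := by
  refine continuous_iff_continuousAt.2 fun y => ?_
  refine ContinuousAt.comp (f := fun y : ℝ => (c + y * Complex.I : ℂ))
    (Complex.differentiableAt_Gamma _ fun m h => ?_).continuousAt (by fun_prop)
  have := congrArg Complex.re h
  simp at this
  linarith [(Nat.cast_nonneg m : (0 : ℝ) ≤ m)]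

theorem continuous_Gamma_mul_Gamma_one_sub {c : ℝ} (h0 : 0 < c) (h1 : c < 1) :
    Continuous fun y : ℝ =>
      Complex.Gamma (c + y * Complex.I) * Complex.Gamma (1 - (c + y * Complex.I)) := by
  refine (continuous_Gamma_line h0).mul ?_
  have := (continuous_Gamma_line (c := 1 - c) (by linarith)).comp continuous_neg
  refine this.congr fun y => ?_
  simp only [Function.comp]
  congr 1
  push_cast
  ring

theorem integrable_Gamma_mul_Gamma_one_sub {c : ℝ} (h0 : 0 < c) (h1 : c < 1) :
    Integrable fun y : ℝ =>
      Complex.Gamma (c + y * Complex.I) * Complex.Gamma (1 - (c + y * Complex.I)) :=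
  (integrable_inv_one_add_sq.const_mul _).mono'
    (continuous_Gamma_mul_Gamma_one_sub h0 h1).aestronglyMeasurable
    (ae_of_all _ (norm_Gamma_mul_Gamma_one_sub_le h0 h1))

theorem inv_one_add_eq_mellinBarnes {c : ℝ} (h0 : 0 < c) (h1 : c < 1) {x : ℝ} (hx : 0 < x) :
    (((1 + x)⁻¹ : ℝ) : ℂ) = (1 / (2 * Real.pi) : ℝ) * ∫ y : ℝ,
      (x : ℂ) ^ (-(c + y * Complex.I)) *
        (Complex.Gamma (c + y * Complex.I) * Complex.Gamma (1 - (c + y * Complex.I))) := by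
  have hm : ∀ y : ℝ, mellin (fun x : ℝ => (((1 + x)⁻¹ : ℝ) : ℂ)) (c + y * Complex.I) =
      Complex.Gamma (c + y * Complex.I) * Complex.Gamma (1 - (c + y * Complex.I)) := fun y =>
    mellin_inv_one_add (by simpa using h0) (by simpa using h1)
  have hinv := mellinInv_mellin_eq c (fun x : ℝ => (((1 + x)⁻¹ : ℝ) : ℂ)) hx
    (mellinConvergent_inv_one_add (by simpa using h0) (by simpa using h1))
    (by
      simp only [Complex.VerticalIntegrable, hm]
      exact integrable_Gamma_mul_Gamma_one_sub h0 h1)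
    (by
      refine Complex.continuous_ofReal.continuousAt.comp ?_
      exact ContinuousAt.inv₀ (by fun_prop) (by positivity))
  rw [← hinv, mellinInv]
  simp only [hm, smul_eq_mul, Complex.real_smul]

/-- The reflection `s ↦ 1 - s` preserves the kernel and turns `x ^ (-s)` into `x ^ (s - 1)`, whose
integration produces `x ^ s / s`. -/
theorem inv_one_add_eq_mellinBarnes' {c : ℝ} (h0 : 0 < c) (h1 : c < 1) {x : ℝ} (hx : 0 < x) :
    (((1 + x)⁻¹ : ℝ) : ℂ) = (1 / (2 * Real.pi) : ℝ) * ∫ y : ℝ,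
      (x : ℂ) ^ (c + y * Complex.I - 1) *
        (Complex.Gamma (c + y * Complex.I) * Complex.Gamma (1 - (c + y * Complex.I))) := by
  rw [inv_one_add_eq_mellinBarnes (c := 1 - c) (by linarith) (by linarith) hx,
    ← integral_neg_eq_self]
  congr 2 with y
  have e : (((1 - c : ℝ) : ℂ) + ((-y : ℝ) : ℂ) * Complex.I) = 1 - (c + y * Complex.I) := by
    push_cast; ring
  rw [e, sub_sub_cancel, neg_sub]
  ring

/-! ### Mellin–Barnes integral of the logarithm -/

theorem integral_Ioc_cpow_sub_one {s : ℂ} (hs : 0 < s.re) :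
    ∫ u in Ioc (0 : ℝ) 1, (u : ℂ) ^ (s - 1) = 1 / s := by
  have hne : s ≠ 0 := by
    rintro rfl
    simp at hs
  rw [← intervalIntegral.integral_of_le zero_le_one,
    integral_cpow (Or.inl (by simpa using hs))]
  simp [hne]

theorem integral_Ioc_mul_inv_one_add {x : ℝ} (hx : 0 < x) :
    ∫ u in Ioc (0 : ℝ) 1, x * (1 + u * x)⁻¹ = Real.log (1 + x) := by
  have hpos : ∀ u ∈ uIcc (0 : ℝ) 1, 0 < 1 + u * x := by
    intro u hu
    rw [uIcc_of_le zero_le_one] at hu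
    have := mul_nonneg hu.1 hx.le
    linarith
  rw [← intervalIntegral.integral_of_le zero_le_one,
    intervalIntegral.integral_eq_sub_of_hasDerivAt (f := fun u => Real.log (1 + u * x))]
  · simp
  · intro u hu
    have h := (((hasDerivAt_id u).mul_const x).const_add 1).log (hpos u hu).ne'
    simpa [div_eq_mul_inv] using h
  · refine ContinuousOn.intervalIntegrable ?_
    exact continuousOn_const.mul (ContinuousOn.inv₀ (by fun_prop) fun u hu => (hpos u hu).ne')

/-- The Mellin-Barnes kernel of `log (1 + x)`. -/
noncomputable def logKernel (s : ℂ) : ℂ := Complex.Gamma s * Complex.Gamma (1 - s) / s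

theorem continuous_logKernel {c : ℝ} (h0 : 0 < c) (h1 : c < 1) :
    Continuous fun y : ℝ => logKernel (c + y * Complex.I) :=
  (continuous_Gamma_mul_Gamma_one_sub h0 h1).div (by fun_prop) fun y => Gamma_line_ne_zero h0 y

theorem integrable_logKernel {c : ℝ} (h0 : 0 < c) (h1 : c < 1) :
    Integrable fun y : ℝ => logKernel (c + y * Complex.I) := by
  refine ((integrable_Gamma_mul_Gamma_one_sub h0 h1).norm.const_mul c⁻¹).mono'
    (continuous_logKernel h0 h1).aestronglyMeasurable (ae_of_all _ fun y => ?_)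
  have hc : c ≤ ‖(c + y * Complex.I : ℂ)‖ := by
    have := Complex.re_le_norm (c + y * Complex.I : ℂ)
    simpa using this
  rw [logKernel, norm_div, div_eq_inv_mul]
  gcongr

/-- `log (1 + x)` as a Mellin-Barnes integral along a vertical line in the strip `0 < Re s < 1`. -/
theorem log_one_add_eq_mellinBarnes {c : ℝ} (h0 : 0 < c) (h1 : c < 1) {x : ℝ} (hx : 0 < x) :
    (Real.log (1 + x) : ℂ) = (1 / (2 * Real.pi) : ℝ) * ∫ y : ℝ,
      logKernel (c + y * Complex.I) * (x : ℂ) ^ (c + y * Complex.I) := by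
  have hx' : (x : ℂ) ≠ 0 := by exact_mod_cast hx.ne'
  let h : ℝ → ℂ := fun y =>
    Complex.Gamma (c + y * Complex.I) * Complex.Gamma (1 - (c + y * Complex.I))
  let F : ℝ → ℝ → ℂ := fun u y =>
    (u : ℂ) ^ (c + y * Complex.I - 1) * (h y * (x : ℂ) ^ (c + y * Complex.I))
  have hmeas : Measurable (Function.uncurry F) := by
    have := (continuous_Gamma_mul_Gamma_one_sub h0 h1).measurable
    have h2 : Measurable h := this
    simp only [F]
    fun_prop
  -- The norm of `F u y` is a product of `u ^ (c - 1)`, integrable on `(0, 1]` since `c > 0`, and a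
  -- function of `y` alone.
  have hint : Integrable (Function.uncurry F) ((volume.restrict (Ioc 0 1)).prod volume) := by
    have i1 : Integrable (fun u : ℝ => u ^ (c - 1)) (volume.restrict (Ioc 0 1)) := by
      have := intervalIntegral.intervalIntegrable_rpow' (a := 0) (b := 1) (r := c - 1)
        (by linarith)
      rwa [intervalIntegrable_iff_integrableOn_Ioc_of_le zero_le_one] at this
    have i2 : Integrable (fun y : ℝ => ‖h y‖ * x ^ c) :=
      (integrable_Gamma_mul_Gamma_one_sub h0 h1).norm.mul_const _
    refine (i1.mul_prod i2).mono' hmeas.aestronglyMeasurable ?_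
    have : ∀ᵐ p : ℝ × ℝ ∂((volume.restrict (Ioc 0 1)).prod volume), p.1 ∈ Ioc (0 : ℝ) 1 :=
      Measure.quasiMeasurePreserving_fst.ae (ae_restrict_mem measurableSet_Ioc)
    filter_upwards [this] with p hp
    simp only [F, Function.uncurry, norm_mul, Complex.norm_cpow_eq_rpow_re_of_pos hp.1,
      Complex.norm_cpow_eq_rpow_re_of_pos hx]
    simp
  have hu : ∀ u ∈ Ioc (0 : ℝ) 1, ((x * (1 + u * x)⁻¹ : ℝ) : ℂ) =
      (1 / (2 * Real.pi) : ℝ) * ∫ y : ℝ, F u y := by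
    intro u hu
    rw [Complex.ofReal_mul, inv_one_add_eq_mellinBarnes' h0 h1 (mul_pos hu.1 hx),
      mul_left_comm, ← integral_const_mul]
    congr 2 with y
    simp only [F, h]
    rw [Complex.ofReal_mul, Complex.mul_cpow_ofReal_nonneg hu.1.le hx.le,
      Complex.cpow_sub (x := (x : ℂ)) _ _ hx', Complex.cpow_one]
    field_simp
  rw [← integral_Ioc_mul_inv_one_add hx, ← integral_complex_ofReal,
    setIntegral_congr_fun measurableSet_Ioc hu, integral_const_mul,
    integral_integral_swap hint]
  congr 2 with y
  simp only [F]
  rw [integral_mul_const, integral_Ioc_cpow_sub_one (by simpa using h0), logKernel]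
  simp only [h]
  ring

/-- The expectation of `log (1 + X)` for a positive random variable `X` in terms of the moments
`E X ^ s` on a vertical line. -/
theorem integral_log_one_add {S : Type*} [MeasurableSpace S] {P : Measure S} [SFinite P]
    {X : S → ℝ} (hX : AEMeasurable X P) (hpos : ∀ᵐ ω ∂P, 0 < X ω) {c : ℝ} (h0 : 0 < c)
    (h1 : c < 1) (hmom : Integrable (fun ω => X ω ^ c) P) :
    ((∫ ω, Real.log (1 + X ω) ∂P : ℝ) : ℂ) = (1 / (2 * Real.pi) : ℝ) * ∫ y : ℝ,
      logKernel (c + y * Complex.I) * ∫ ω, (X ω : ℂ) ^ (c + y * Complex.I) ∂P := by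
  let F : S → ℝ → ℂ := fun ω y =>
    logKernel (c + y * Complex.I) * (X ω : ℂ) ^ (c + y * Complex.I)
  have hmeas : AEStronglyMeasurable (Function.uncurry F) (P.prod volume) := by
    have h2 : Measurable fun y : ℝ => logKernel (c + y * Complex.I) :=
      (continuous_logKernel h0 h1).measurable
    have hX1 : AEMeasurable (fun p : S × ℝ => X p.1) (P.prod volume) := hX.comp_fst
    have h3 : AEMeasurable (fun p : S × ℝ => logKernel (c + p.2 * Complex.I)) (P.prod volume) :=
      (h2.comp measurable_snd).aemeasurable
    have h4 : AEMeasurable (fun p : S × ℝ => (c + p.2 * Complex.I : ℂ)) (P.prod volume) := by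
      fun_prop
    have h5 : AEMeasurable (fun p : S × ℝ => (X p.1 : ℂ)) (P.prod volume) := by
      fun_prop
    exact (h3.mul (h5.pow h4)).aestronglyMeasurable
  have hint : Integrable (Function.uncurry F) (P.prod volume) := by
    refine (hmom.mul_prod (integrable_logKernel h0 h1).norm).mono' hmeas ?_
    have : ∀ᵐ p : S × ℝ ∂(P.prod volume), 0 < X p.1 :=
      Measure.quasiMeasurePreserving_fst.ae hpos
    filter_upwards [this] with p hp
    simp only [F, Function.uncurry, norm_mul, Complex.norm_cpow_eq_rpow_re_of_pos hp]
    simp [mul_comm]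
  have hω : (fun ω => (Real.log (1 + X ω) : ℂ)) =ᵐ[P]
      fun ω => (1 / (2 * Real.pi) : ℝ) * ∫ y : ℝ, F ω y := by
    filter_upwards [hpos] with ω hω
    exact log_one_add_eq_mellinBarnes h0 h1 hω
  rw [← integral_complex_ofReal, integral_congr_ae hω, integral_const_mul,
    integral_integral_swap hint]
  simp only [F, integral_const_mul]

/-! ### The Nakagami distribution and its moments -/

variable {m w : ℝ}

theorem nakagamiPDFReal_of_pos {x : ℝ} (hx : 0 < x) : nakagamiPDFReal m w x =
    2 * m ^ m / (Real.Gamma m * w ^ m) * x ^ (2 * m - 1) * Real.exp (-(m / w) * x ^ 2) :=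
  if_pos hx

theorem nakagamiPDFReal_of_nonpos {x : ℝ} (hx : x ≤ 0) : nakagamiPDFReal m w x = 0 :=
  if_neg hx.not_gt

theorem nakagamiPDFReal_nonneg (hm : 0 < m) (hw : 0 < w) (x : ℝ) : 0 ≤ nakagamiPDFReal m w x := by
  rcases lt_or_ge 0 x with hx | hx
  · rw [nakagamiPDFReal_of_pos hx]
    have := Real.Gamma_pos_of_pos hm
    positivity
  · rw [nakagamiPDFReal_of_nonpos hx]

theorem measurable_nakagamiPDFReal : Measurable (nakagamiPDFReal m w) := by
  unfold nakagamiPDFReal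
  exact Measurable.ite measurableSet_Ioi (by fun_prop) measurable_const

theorem nakagamiMeasure_absolutelyContinuous : nakagamiMeasure m w ≪ volume :=
  withDensity_absolutelyContinuous _ _

theorem ae_pos_nakagamiMeasure : ∀ᵐ x ∂nakagamiMeasure m w, 0 < x := by
  rw [nakagamiMeasure, ae_withDensity_iff measurable_nakagamiPDFReal.ennreal_ofReal]
  refine ae_of_all _ fun x hx => ?_
  by_contra h
  exact hx (by rw [nakagamiPDFReal_of_nonpos (not_lt.1 h), ENNReal.ofReal_zero])

theorem integrable_nakagamiMeasure_iff (hm : 0 < m) (hw : 0 < w) {f : ℝ → ℝ} :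
    Integrable f (nakagamiMeasure m w) ↔
      IntegrableOn (fun x => nakagamiPDFReal m w x * f x) (Ioi 0) := by
  rw [nakagamiMeasure, integrable_withDensity_iff_integrable_smul'
    measurable_nakagamiPDFReal.ennreal_ofReal (ae_of_all _ fun _ => ENNReal.ofReal_lt_top),
    ← integrable_indicator_iff measurableSet_Ioi]
  refine integrable_congr (ae_of_all _ fun x => ?_)
  simp only [smul_eq_mul, ENNReal.toReal_ofReal (nakagamiPDFReal_nonneg hm hw x)]
  by_cases hx : x ∈ Ioi (0 : ℝ)
  · rw [indicator_of_mem hx]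
  · rw [indicator_of_notMem hx, nakagamiPDFReal_of_nonpos (not_lt.1 hx), zero_mul]

theorem integral_nakagamiMeasure (hm : 0 < m) (hw : 0 < w) (f : ℝ → ℂ) :
    ∫ x, f x ∂nakagamiMeasure m w = ∫ x in Ioi (0 : ℝ), (nakagamiPDFReal m w x : ℂ) * f x := by
  rw [nakagamiMeasure, integral_withDensity_eq_integral_toReal_smul
    measurable_nakagamiPDFReal.ennreal_ofReal (ae_of_all _ fun _ => ENNReal.ofReal_lt_top),
    ← integral_indicator measurableSet_Ioi]
  refine integral_congr_ae (ae_of_all _ fun x => ?_)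
  simp only [Complex.real_smul, ENNReal.toReal_ofReal (nakagamiPDFReal_nonneg hm hw x)]
  by_cases hx : x ∈ Ioi (0 : ℝ)
  · rw [indicator_of_mem hx]
  · rw [indicator_of_notMem hx, nakagamiPDFReal_of_nonpos (not_lt.1 hx), Complex.ofReal_zero,
      zero_mul]

theorem integrable_sq_rpow_nakagamiMeasure (hm : 0 < m) (hw : 0 < w) {c : ℝ} (hc : 0 ≤ c) :
    Integrable (fun x : ℝ => (x ^ 2) ^ c) (nakagamiMeasure m w) := by
  rw [integrable_nakagamiMeasure_iff hm hw]
  have h := integrableOn_rpow_mul_exp_neg_mul_rpow (s := 2 * m - 1 + 2 * c) (p := 2) (b := m / w)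
    (by linarith) two_pos (by positivity)
  refine (h.const_mul (2 * m ^ m / (Real.Gamma m * w ^ m))).congr ?_
  filter_upwards [ae_restrict_mem measurableSet_Ioi] with x hx
  have hx : 0 < x := hx
  rw [nakagamiPDFReal_of_pos hx, Real.rpow_add hx, ← Real.rpow_two, ← Real.rpow_mul hx.le]
  ring

/-- The moments of the square of a Nakagami variable. -/
theorem integral_sq_cpow_nakagamiMeasure (hm : 0 < m) (hw : 0 < w) {s : ℂ} (hs : 0 < s.re) :
    ∫ x, ((x ^ 2 : ℝ) : ℂ) ^ s ∂nakagamiMeasure m w =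
      Complex.Gamma (m + s) / Real.Gamma m * ((w / m : ℝ) : ℂ) ^ s := by
  have hG := (Real.Gamma_pos_of_pos hm).ne'
  let C : ℝ := m ^ m / (Real.Gamma m * w ^ m)
  -- The square of a Nakagami variable is Gamma distributed with shape `m` and rate `m / w`; `g` is
  -- that density times `y ^ s`, reached by substituting `y = x²`.
  let g : ℝ → ℂ := fun y =>
    (C : ℂ) * ((y : ℂ) ^ (m + s - 1) * Complex.exp (-((m / w : ℝ) * y)))
  have hg : ∀ x ∈ Ioi (0 : ℝ), (nakagamiPDFReal m w x : ℂ) * ((x ^ 2 : ℝ) : ℂ) ^ s =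
      (2 * x ^ ((2 : ℝ) - 1)) • g (x ^ (2 : ℝ)) := by
    intro x hx
    have hx : 0 < x := hx
    have hx2 : ((x ^ 2 : ℝ) : ℂ) ≠ 0 := by exact_mod_cast (pow_pos hx 2).ne'
    rw [nakagamiPDFReal_of_pos hx, Real.rpow_two]
    simp only [g, C, Complex.real_smul]
    have e1 : ((x ^ 2 : ℝ) : ℂ) ^ (m + s - 1 : ℂ) =
        ((x ^ (2 * m - 2) : ℝ) : ℂ) * ((x ^ 2 : ℝ) : ℂ) ^ s := by
      rw [show (m + s - 1 : ℂ) = ((m - 1 : ℝ) : ℂ) + s by push_cast; ring,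
        Complex.cpow_add _ _ hx2, ← Complex.ofReal_cpow (by positivity), ← Real.rpow_two,
        ← Real.rpow_mul hx.le]
      ring_nf
    have e2 : x ^ (2 * m - 1) = x ^ ((2 : ℝ) - 1) * x ^ (2 * m - 2) := by
      rw [← Real.rpow_add hx]
      ring_nf
    have e3 : Complex.exp (-((m / w : ℝ) * (x ^ 2 : ℝ))) =
        ((Real.exp (-(m / w) * x ^ 2) : ℝ) : ℂ) := by
      push_cast
      ring_nf
    rw [e1, e2, e3]
    push_cast
    ring
  rw [integral_nakagamiMeasure hm hw, setIntegral_congr_fun measurableSet_Ioi hg,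
    integral_comp_rpow_Ioi_of_pos two_pos]
  simp only [g]
  have hmw : 0 < m / w := by positivity
  rw [integral_const_mul, Complex.integral_cpow_mul_exp_neg_mul_Ioi (by simp; linarith) hmw,
    one_div, ← Complex.ofReal_inv, inv_div]
  have hwm : ((w / m : ℝ) : ℂ) ≠ 0 := by exact_mod_cast (by positivity : w / m ≠ 0)
  rw [Complex.cpow_add _ _ hwm, ← Complex.ofReal_cpow (by positivity), Real.div_rpow hw.le hm.le]
  have h1 : ((m ^ m : ℝ) : ℂ) ≠ 0 := by exact_mod_cast (Real.rpow_pos_of_pos hm m).ne'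
  have h2 : ((w ^ m : ℝ) : ℂ) ≠ 0 := by exact_mod_cast (Real.rpow_pos_of_pos hw m).ne'
  have h3 : ((Real.Gamma m : ℝ) : ℂ) ≠ 0 := by exact_mod_cast hG
  simp only [C]
  rw [Complex.ofReal_div, Complex.ofReal_div (w ^ m), Complex.ofReal_mul]
  field_simp

/-! ### The Meijer function of the capacity formula -/

/-- The left poles are `-k` and `-mᵢ - k`, with maximum `0`; the right poles are `1 + k`, with
minimum `1`. -/
theorem isSeparating_logMoment_iff {m₁ m₂ c : ℝ} (hm₁ : 0 < m₁) (hm₂ : 0 < m₂) :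
    IsSeparating 1 4 ![1, 1, 1 - (m₁ : ℂ), 1 - (m₂ : ℂ)] ![1, 0] c ↔ 0 < c ∧ c < 1 := by
  constructor
  · rintro ⟨hl, hr⟩
    have h0 := hl 0 (by norm_num) 0
    have h1 := hr 0 (by norm_num) 0
    simp at h0 h1
    exact ⟨h0, h1⟩
  · rintro ⟨h0, h1⟩
    refine ⟨fun j _ k => ?_, fun j hj k => ?_⟩
    · have hk : (0 : ℝ) ≤ k := Nat.cast_nonneg k
      fin_cases j <;> simp <;> linarith
    · have hk : (0 : ℝ) ≤ k := Nat.cast_nonneg k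
      have : j = 0 := by
        ext
        simpa using hj
      subst this
      simp
      linarith

/-- The two upper parameters `1` give `Γ(s)²`, and the lower parameter `0` gives `Γ(1 + s) = s Γ(s)`
in the denominator, so one `Γ(s)` cancels and `1 / s` remains. -/
theorem meijerGIntegrand_logMoment (m₁ m₂ : ℝ) (z : ℂ) {s : ℂ} (hs : 0 < s.re) :
    meijerGIntegrand 1 4 ![1, 1, 1 - (m₁ : ℂ), 1 - (m₂ : ℂ)] ![1, 0] z s =
      logKernel s * (Complex.Gamma (m₁ + s) * Complex.Gamma (m₂ + s) * z ^ s) := by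
  have hne : s ≠ 0 := by
    rintro rfl
    simp at hs
  have hG : Complex.Gamma s ≠ 0 := Complex.Gamma_ne_zero_of_re_pos hs
  have f1 : (Finset.univ.filter fun j : Fin 2 => j.val < 1) = {0} := by decide
  have f2 : (Finset.univ.filter fun j : Fin 4 => j.val < 4) = Finset.univ := by decide
  have f3 : (Finset.univ.filter fun j : Fin 2 => 1 ≤ j.val) = {1} := by decide
  have f4 : (Finset.univ.filter fun j : Fin 4 => 4 ≤ j.val) = ∅ := by decide
  have hadd : Complex.Gamma (1 + s) = s * Complex.Gamma s := by
    rw [add_comm, Complex.Gamma_add_one s hne]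
  rw [meijerGIntegrand, f1, f2, f3, f4, logKernel]
  simp [Fin.prod_univ_four, hadd]
  field_simp

theorem integrable_meijerGIntegrand_logMoment {m₁ m₂ : ℝ} (hm₁ : 0 < m₁) (hm₂ : 0 < m₂) {z c : ℝ}
    (hz : 0 < z) (h0 : 0 < c) (h1 : c < 1) :
    Integrable fun y : ℝ => meijerGIntegrand 1 4 ![1, 1, 1 - (m₁ : ℂ), 1 - (m₂ : ℂ)] ![1, 0] z
      (c + y * Complex.I) := by
  have hcont : ∀ {m : ℝ}, 0 < m → Continuous fun y : ℝ =>
      Complex.Gamma (m + (c + y * Complex.I)) := by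
    intro m hm
    refine (continuous_Gamma_line (c := m + c) (by linarith)).congr fun y => ?_
    rw [Complex.ofReal_add, add_assoc]
  have hbd : ∀ {m : ℝ}, 0 < m → ∀ y : ℝ,
      ‖Complex.Gamma (m + (c + y * Complex.I))‖ ≤ Real.Gamma (m + c) := by
    intro m hm y
    have := norm_Gamma_le (s := m + (c + y * Complex.I)) (by simp; linarith)
    simpa using this
  have hz' : (z : ℂ) ≠ 0 := by exact_mod_cast hz.ne'
  have heq : ∀ y : ℝ, meijerGIntegrand 1 4 ![1, 1, 1 - (m₁ : ℂ), 1 - (m₂ : ℂ)] ![1, 0] z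
      (c + y * Complex.I) = logKernel (c + y * Complex.I) *
        (Complex.Gamma (m₁ + (c + y * Complex.I)) * Complex.Gamma (m₂ + (c + y * Complex.I)) *
          (z : ℂ) ^ (c + y * Complex.I)) := fun y =>
    meijerGIntegrand_logMoment m₁ m₂ z (by simpa using h0)
  simp only [heq]
  refine (integrable_logKernel h0 h1).mul_bdd
    (c := Real.Gamma (m₁ + c) * Real.Gamma (m₂ + c) * z ^ c) ?_ (ae_of_all _ fun y => ?_)
  · exact (((hcont hm₁).mul (hcont hm₂)).mul
      (Continuous.const_cpow (by fun_prop) (Or.inl hz'))).aestronglyMeasurable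
  · rw [norm_mul, norm_mul, Complex.norm_cpow_eq_rpow_re_of_pos hz]
    have := Real.Gamma_pos_of_pos (add_pos hm₁ h0)
    have hre : (c + y * Complex.I : ℂ).re = c := by simp
    rw [hre]
    gcongr
    · exact hbd hm₁ y
    · exact hbd hm₂ y

theorem meijerGConverges_logMoment {m₁ m₂ : ℝ} (hm₁ : 0 < m₁) (hm₂ : 0 < m₂) {z : ℝ}
    (hz : 0 < z) :
    MeijerGConverges 1 4 ![1, 1, 1 - (m₁ : ℂ), 1 - (m₂ : ℂ)] ![1, 0] (z : ℂ) := by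
  refine ⟨⟨1 / 2, (isSeparating_logMoment_iff hm₁ hm₂).2 (by norm_num)⟩, fun c hc => ?_⟩
  obtain ⟨h0, h1⟩ := (isSeparating_logMoment_iff hm₁ hm₂).1 hc
  exact integrable_meijerGIntegrand_logMoment hm₁ hm₂ hz h0 h1

/-! ### Products of independent Nakagami variables -/

section Product

variable {S : Type*} [MeasurableSpace S] {P : Measure S} {Z₁ Z₂ : S → ℝ} {m₁ w₁ m₂ w₂ : ℝ}

theorem ae_pos_of_hasLaw_nakagami (hZ : HasLaw Z₁ (nakagamiMeasure m₁ w₁) P) :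
    ∀ᵐ ω ∂P, 0 < Z₁ ω :=
  ae_of_ae_map hZ.aemeasurable (hZ.map_eq ▸ ae_pos_nakagamiMeasure)

theorem integrable_sq_rpow_of_hasLaw_nakagami (hm : 0 < m₁) (hw : 0 < w₁)
    (hZ : HasLaw Z₁ (nakagamiMeasure m₁ w₁) P) {c : ℝ} (hc : 0 ≤ c) :
    Integrable (fun ω => (Z₁ ω ^ 2) ^ c) P := by
  have h := integrable_sq_rpow_nakagamiMeasure hm hw hc
  rw [← hZ.map_eq] at h
  exact h.comp_aemeasurable hZ.aemeasurable

theorem integral_sq_cpow_of_hasLaw_nakagami (hm : 0 < m₁) (hw : 0 < w₁)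
    (hZ : HasLaw Z₁ (nakagamiMeasure m₁ w₁) P) {s : ℂ} (hs : 0 < s.re) :
    ∫ ω, ((Z₁ ω ^ 2 : ℝ) : ℂ) ^ s ∂P =
      Complex.Gamma (m₁ + s) / Real.Gamma m₁ * ((w₁ / m₁ : ℝ) : ℂ) ^ s := by
  have hf : Measurable fun x : ℝ => ((x ^ 2 : ℝ) : ℂ) ^ s := by fun_prop
  rw [← integral_sq_cpow_nakagamiMeasure hm hw hs, ← hZ.map_eq,
    integral_map hZ.aemeasurable hf.aestronglyMeasurable]

/-- Only absolute continuity has to be shown. For fixed `x > 0`, the slice of the preimage of a null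
set is its preimage under `y ↦ K x y`, a nonzero scaling, hence null. -/
theorem hasPDF_mul_of_hasLaw_nakagami [IsProbabilityMeasure P]
    (hZ₁ : HasLaw Z₁ (nakagamiMeasure m₁ w₁) P) (hZ₂ : HasLaw Z₂ (nakagamiMeasure m₂ w₂) P)
    (hindep : IndepFun Z₁ Z₂ P) {K : ℝ} (hK : K ≠ 0) :
    HasPDF (fun ω => K * Z₁ ω * Z₂ ω) P volume := by
  have hm : AEMeasurable (fun ω => K * Z₁ ω * Z₂ ω) P :=
    (hZ₁.aemeasurable.const_mul K).mul hZ₂.aemeasurable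
  have hpair := hindep.map_prod_eq_prod_map_map hZ₁.aemeasurable hZ₂.aemeasurable
  have hf : Measurable fun p : ℝ × ℝ => K * p.1 * p.2 := by fun_prop
  have hmap : P.map (fun ω => K * Z₁ ω * Z₂ ω) =
      ((P.map Z₁).prod (P.map Z₂)).map fun p : ℝ × ℝ => K * p.1 * p.2 := by
    rw [← hpair, AEMeasurable.map_map_of_aemeasurable hf.aemeasurable
      (hZ₁.aemeasurable.prodMk hZ₂.aemeasurable)]
    rfl
  have : IsProbabilityMeasure (P.map Z₂) := Measure.isProbabilityMeasure_map hZ₂.aemeasurable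
  rw [Real.hasPDF_iff_of_aemeasurable hm, hmap]
  refine Measure.AbsolutelyContinuous.mk fun s hs h0 => ?_
  rw [Measure.map_apply hf hs, Measure.measure_prod_null (hf hs), hZ₁.map_eq, hZ₂.map_eq]
  filter_upwards [ae_pos_nakagamiMeasure] with x hx
  refine nakagamiMeasure_absolutelyContinuous ?_
  have : Prod.mk x ⁻¹' ((fun p : ℝ × ℝ => K * p.1 * p.2) ⁻¹' s) = (fun y => K * x * y) ⁻¹' s := rfl
  rw [this, Real.volume_preimage_mul_left (mul_ne_zero hK hx.ne'), h0, mul_zero]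

theorem integrable_rpow_mul_sq_of_hasLaw_nakagami (hm₁ : 0 < m₁) (hw₁ : 0 < w₁) (hm₂ : 0 < m₂)
    (hw₂ : 0 < w₂) (hZ₁ : HasLaw Z₁ (nakagamiMeasure m₁ w₁) P)
    (hZ₂ : HasLaw Z₂ (nakagamiMeasure m₂ w₂) P) (hindep : IndepFun Z₁ Z₂ P) {A : ℝ} (hA : 0 ≤ A)
    {c : ℝ} (hc : 0 ≤ c) : Integrable (fun ω => (A * (Z₁ ω ^ 2 * Z₂ ω ^ 2)) ^ c) P := by
  have hmeas : Measurable fun x : ℝ => (x ^ 2) ^ c := by fun_prop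
  have h := (hindep.comp hmeas hmeas).integrable_mul
    (integrable_sq_rpow_of_hasLaw_nakagami hm₁ hw₁ hZ₁ hc)
    (integrable_sq_rpow_of_hasLaw_nakagami hm₂ hw₂ hZ₂ hc)
  refine (h.const_mul (A ^ c)).congr (ae_of_all _ fun ω => ?_)
  simp only [Pi.mul_apply, Function.comp]
  rw [Real.mul_rpow hA (by positivity), Real.mul_rpow (by positivity) (by positivity)]

theorem integral_cpow_mul_sq_of_hasLaw_nakagami (hm₁ : 0 < m₁) (hw₁ : 0 < w₁) (hm₂ : 0 < m₂)
    (hw₂ : 0 < w₂) (hZ₁ : HasLaw Z₁ (nakagamiMeasure m₁ w₁) P)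
    (hZ₂ : HasLaw Z₂ (nakagamiMeasure m₂ w₂) P) (hindep : IndepFun Z₁ Z₂ P) {A : ℝ} (hA : 0 < A)
    {s : ℂ} (hs : 0 < s.re) :
    ∫ ω, ((A * (Z₁ ω ^ 2 * Z₂ ω ^ 2) : ℝ) : ℂ) ^ s ∂P =
      (1 / (Real.Gamma m₁ * Real.Gamma m₂) : ℝ) * (Complex.Gamma (m₁ + s) *
        Complex.Gamma (m₂ + s) * ((A * (w₁ / m₁ * (w₂ / m₂)) : ℝ) : ℂ) ^ s) := by
  have hmeas : Measurable fun x : ℝ => ((x ^ 2 : ℝ) : ℂ) ^ s := by fun_prop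
  have hsplit : ∀ {a b : ℝ}, 0 ≤ a → 0 ≤ b → ((A * (a * b) : ℝ) : ℂ) ^ s =
      (A : ℂ) ^ s * ((a : ℂ) ^ s * (b : ℂ) ^ s) := by
    intro a b ha hb
    rw [Complex.ofReal_mul, Complex.mul_cpow_ofReal_nonneg hA.le (mul_nonneg ha hb),
      Complex.ofReal_mul, Complex.mul_cpow_ofReal_nonneg ha hb]
  have he : ∀ ω, ((A * (Z₁ ω ^ 2 * Z₂ ω ^ 2) : ℝ) : ℂ) ^ s =
      (A : ℂ) ^ s * (((Z₁ ω ^ 2 : ℝ) : ℂ) ^ s * ((Z₂ ω ^ 2 : ℝ) : ℂ) ^ s) := fun ω =>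
    hsplit (sq_nonneg _) (sq_nonneg _)
  simp only [he]
  rw [integral_const_mul, hindep.integral_fun_comp_mul_comp hZ₁.aemeasurable hZ₂.aemeasurable
      (f := fun x : ℝ => ((x ^ 2 : ℝ) : ℂ) ^ s) (g := fun x : ℝ => ((x ^ 2 : ℝ) : ℂ) ^ s)
      hmeas.aestronglyMeasurable hmeas.aestronglyMeasurable,
    integral_sq_cpow_of_hasLaw_nakagami hm₁ hw₁ hZ₁ hs,
    integral_sq_cpow_of_hasLaw_nakagami hm₂ hw₂ hZ₂ hs, hsplit (by positivity) (by positivity)]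
  push_cast
  ring

/-- The mean of `log (1 + A Z₁² Z₂²)` for independent Nakagami variables `Z₁`, `Z₂`. -/
theorem integral_log_one_add_mul_sq_eq_meijerG [IsProbabilityMeasure P] (hm₁ : 0 < m₁)
    (hw₁ : 0 < w₁) (hm₂ : 0 < m₂) (hw₂ : 0 < w₂) (hZ₁ : HasLaw Z₁ (nakagamiMeasure m₁ w₁) P)
    (hZ₂ : HasLaw Z₂ (nakagamiMeasure m₂ w₂) P) (hindep : IndepFun Z₁ Z₂ P) {A : ℝ} (hA : 0 < A) :
    ((∫ ω, Real.log (1 + A * (Z₁ ω ^ 2 * Z₂ ω ^ 2)) ∂P : ℝ) : ℂ) =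
      (1 / (Real.Gamma m₁ * Real.Gamma m₂) : ℝ) *
        meijerG 1 4 ![1, 1, 1 - (m₁ : ℂ), 1 - (m₂ : ℂ)] ![1, 0]
          ((A * (w₁ / m₁ * (w₂ / m₂)) : ℝ) : ℂ) := by
  have hex : ∃ c : ℝ, IsSeparating 1 4 ![1, 1, 1 - (m₁ : ℂ), 1 - (m₂ : ℂ)] ![1, 0] c :=
    ⟨1 / 2, (isSeparating_logMoment_iff hm₁ hm₂).2 (by norm_num)⟩
  rw [meijerG, dif_pos hex]
  obtain ⟨h0, h1⟩ := (isSeparating_logMoment_iff hm₁ hm₂).1 hex.choose_spec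
  -- Only `0 < c < 1` matters about the chosen line, so independence of the contour is not needed.
  generalize hex.choose = c at h0 h1
  have hX : AEMeasurable (fun ω => A * (Z₁ ω ^ 2 * Z₂ ω ^ 2)) P :=
    ((hZ₁.aemeasurable.pow_const 2).mul (hZ₂.aemeasurable.pow_const 2)).const_mul A
  have hpos : ∀ᵐ ω ∂P, 0 < A * (Z₁ ω ^ 2 * Z₂ ω ^ 2) := by
    filter_upwards [ae_pos_of_hasLaw_nakagami hZ₁, ae_pos_of_hasLaw_nakagami hZ₂] with ω p1 p2
    positivity
  rw [integral_log_one_add hX hpos h0 h1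
    (integrable_rpow_mul_sq_of_hasLaw_nakagami hm₁ hw₁ hm₂ hw₂ hZ₁ hZ₂ hindep hA.le h0.le)]
  have hline : ∀ y : ℝ, 0 < (c + y * Complex.I : ℂ).re := fun y => by simpa using h0
  simp only [mellinBarnesIntegral, meijerGIntegrand_logMoment _ _ _ (hline _),
    integral_cpow_mul_sq_of_hasLaw_nakagami hm₁ hw₁ hm₂ hw₂ hZ₁ hZ₂ hindep hA (hline _)]
  rw [integral_mul_const]
  simp only [mul_left_comm (logKernel _) ((1 / (Real.Gamma m₁ * Real.Gamma m₂) : ℝ) : ℂ)]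
  rw [integral_const_mul]
  have hI := Complex.I_ne_zero
  have hpi : (Real.pi : ℂ) ≠ 0 := by exact_mod_cast Real.pi_ne_zero
  generalize integral (G := ℂ) (volume : Measure ℝ) _ = J
  push_cast
  field_simp

theorem integrable_log_one_add_mul_sq [IsProbabilityMeasure P] (hm₁ : 0 < m₁)
    (hw₁ : 0 < w₁) (hm₂ : 0 < m₂) (hw₂ : 0 < w₂) (hZ₁ : HasLaw Z₁ (nakagamiMeasure m₁ w₁) P)
    (hZ₂ : HasLaw Z₂ (nakagamiMeasure m₂ w₂) P) (hindep : IndepFun Z₁ Z₂ P) {A : ℝ} (hA : 0 ≤ A) :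
    Integrable (fun ω => Real.log (1 + A * (Z₁ ω ^ 2 * Z₂ ω ^ 2))) P := by
  have hX : AEMeasurable (fun ω => A * (Z₁ ω ^ 2 * Z₂ ω ^ 2)) P :=
    ((hZ₁.aemeasurable.pow_const 2).mul (hZ₂.aemeasurable.pow_const 2)).const_mul A
  -- Domination by the first moment (`c = 1`), through `log (1 + X) ≤ X`.
  refine (integrable_rpow_mul_sq_of_hasLaw_nakagami hm₁ hw₁ hm₂ hw₂ hZ₁ hZ₂ hindep hA
    zero_le_one).mono' (hX.const_add 1).log.aestronglyMeasurable (ae_of_all _ fun ω => ?_)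
  have h : 0 ≤ A * (Z₁ ω ^ 2 * Z₂ ω ^ 2) := by positivity
  rw [Real.rpow_one, Real.norm_eq_abs, abs_of_nonneg (Real.log_nonneg (by linarith))]
  linarith [Real.log_le_sub_one_of_pos (by linarith : 0 < 1 + A * (Z₁ ω ^ 2 * Z₂ ω ^ 2))]

end Product

/-! ### The capacity as an expectation, and the final formula -/

/-- The spread is a product of squares and a factor of the numerator of the shape, so it cannot
vanish; no positivity of Bessel functions is used. -/
theorem spreadBar_pos_of_shapeBar_pos {N : ℕ} {m w κ : ℝ} (h : 0 < shapeBar N m w κ) :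
    0 < spreadBar m w κ := by
  have h0 : 0 ≤ spreadBar m w κ := by
    unfold spreadBar
    positivity
  refine h0.lt_of_ne fun he => ?_
  rw [shapeBar, ← he] at h
  simp at h

theorem pathLoss_pos {L : ℕ} {C₀ d₀ : ℝ} {d e : ℕ → ℝ} (hC₀ : 0 < C₀) (hd₀ : 0 < d₀)
    (hd : ∀ i ∈ Finset.Icc 1 (L + 1), 0 < d i) : 0 < pathLoss L C₀ d₀ d e :=
  Finset.prod_pos fun i hi =>
    mul_pos hC₀ (Real.rpow_pos_of_pos (div_pos (hd i hi) hd₀) _)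

section Capacity

variable {S : Type*} [MeasurableSpace S] {P : Measure S} [IsProbabilityMeasure P] {H : S → ℝ}
  [HasPDF H P volume]

theorem integrableOn_capacity_integrand {ρ : ℝ}
    (hint : Integrable (fun ω => Real.log (1 + ρ * H ω ^ 2)) P) :
    IntegrableOn (fun x : ℝ => Real.logb 2 (1 + ρ * x ^ 2) * (pdf H P volume x).toReal)
      (Ioi 0) := by
  have hf : Measurable fun x : ℝ => Real.logb 2 (1 + ρ * x ^ 2) := by
    unfold Real.logb
    fun_prop
  have h := (pdf.integrable_pdf_smul_iff (X := H) (μ := volume)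
    hf.aestronglyMeasurable).2 (hint.div_const (Real.log 2))
  refine h.integrableOn.congr (ae_of_all _ fun x => ?_)
  simp only [smul_eq_mul, mul_comm]

/-- The density formula for expectations is applied to the integrand cut off to the positive axis;
the cutoff disappears because `H > 0` almost surely. -/
theorem ergodicCapacity_eq (hpos : ∀ᵐ ω ∂P, 0 < H ω) (ρ : ℝ) :
    ergodicCapacity P H ρ = (∫ ω, Real.log (1 + ρ * H ω ^ 2) ∂P) / Real.log 2 := by
  have hf : Measurable fun x : ℝ => Real.logb 2 (1 + ρ * x ^ 2) := by
    unfold Real.logb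
    fun_prop
  have h : ∫ x, (pdf H P volume x).toReal •
        (Ioi 0).indicator (fun x : ℝ => Real.logb 2 (1 + ρ * x ^ 2)) x =
      ∫ ω, (Ioi 0).indicator (fun x : ℝ => Real.logb 2 (1 + ρ * x ^ 2)) (H ω) ∂P :=
    pdf.integral_pdf_smul (hf.indicator measurableSet_Ioi).aestronglyMeasurable
  rw [ergodicCapacity, ← integral_indicator measurableSet_Ioi, ← integral_div]
  calc _ = ∫ x, (pdf H P volume x).toReal •
        (Ioi 0).indicator (fun x : ℝ => Real.logb 2 (1 + ρ * x ^ 2)) x := by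
        refine integral_congr_ae (ae_of_all _ fun x => ?_)
        by_cases hx : x ∈ Ioi (0 : ℝ)
        · simp only [indicator_of_mem hx, smul_eq_mul, mul_comm]
        · simp only [indicator_of_notMem hx, smul_zero]
    _ = _ := h.trans (integral_congr_ae (by
        filter_upwards [hpos] with ω hω
        rw [indicator_of_mem (show H ω ∈ Ioi 0 from hω), Real.logb]))

end Capacity

end CascadedRIS

open CascadedRIS in
theorem proposition3 {S : Type*} [MeasurableSpace S] (P : Measure S) [IsProbabilityMeasure P]
    -- the route: number of surfaces, numbers of their elements
    (L : ℕ) (hL : 2 ≤ L) (N : ℕ → ℕ) (hN : ∀ i ∈ Finset.Icc 1 L, 0 < N i)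
    -- fading (shape, spread) and phase error (concentration) at the first and at the last surface
    (m₁ w₁ κ₁ m_L w_L κ_L : ℝ) (hm₁ : 0 < m₁) (hw₁ : 0 < w₁) (hκ₁ : 0 ≤ κ₁)
    (hm_L : 0 < m_L) (hw_L : 0 < w_L) (hκ_L : 0 ≤ κ_L)
    -- path loss, antenna gains, transmit power, noise power
    (C₀ d₀ : ℝ) (hC₀ : 0 < C₀) (hd₀ : 0 < d₀) (d e : ℕ → ℝ)
    (hd : ∀ i ∈ Finset.Icc 1 (L + 1), 0 < d i)
    (Gt Gr Pt σ : ℝ) (hGt : 0 < Gt) (hGr : 0 < Gr) (hPt : 0 < Pt) (hσ : 0 < σ)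
    -- the approximating Nakagami distributions exist
    (hshape₁ : 0 < shapeBar (N 1) m₁ w₁ κ₁) (hshape_L : 0 < shapeBar (N L) m_L w_L κ_L)
    (Z₁ Z_L : S → ℝ)
    (hZ₁ : HasLaw Z₁ (nakagamiMeasure (shapeBar (N 1) m₁ w₁ κ₁) (spreadBar m₁ w₁ κ₁)) P)
    (hZ_L : HasLaw Z_L (nakagamiMeasure (shapeBar (N L) m_L w_L κ_L) (spreadBar m_L w_L κ_L)) P)
    (hindep : IndepFun Z₁ Z_L P) :
    let μ₁ : ℝ := shapeBar (N 1) m₁ w₁ κ₁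
    let μ_L : ℝ := shapeBar (N L) m_L w_L κ_L
    let ω₁ : ℝ := spreadBar m₁ w₁ κ₁
    let ω_L : ℝ := spreadBar m_L w_L κ_L
    let G : ℝ := Gt * Gr
    let l_c : ℝ := pathLoss L C₀ d₀ d e
    let ρ : ℝ := Pt / σ ^ 2 * l_c * G
    let H : S → ℝ := channelAmplitude L N Z₁ Z_L
    let a : Fin 4 → ℂ := ![1, 1, 1 - (μ₁ : ℂ), 1 - (μ_L : ℂ)]
    let b : Fin 2 → ℂ := ![1, 0]
    let z : ℝ := (Pt * G * l_c * ∏ i ∈ Finset.Icc 1 L, (N i : ℝ) ^ 2) /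
      (σ ^ 2 * (μ₁ * μ_L / (ω₁ * ω_L)))
    HasPDF H P volume ∧
      IntegrableOn (fun x : ℝ => Real.logb 2 (1 + ρ * x ^ 2) * (pdf H P volume x).toReal)
        (Set.Ioi 0) ∧
      MeijerGConverges 1 4 a b (z : ℂ) ∧
      ((ergodicCapacity P H ρ : ℝ) : ℂ) =
        1 / ((Real.log 2 * Real.Gamma μ₁ * Real.Gamma μ_L : ℝ) : ℂ) * meijerG 1 4 a b (z : ℂ) := by
  intro μ₁ μ_L ω₁ ω_L G l_c ρ H a b z
  have hω₁ : 0 < ω₁ := spreadBar_pos_of_shapeBar_pos hshape₁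
  have hω_L : 0 < ω_L := spreadBar_pos_of_shapeBar_pos hshape_L
  have hμ₁ : 0 < μ₁ := hshape₁
  have hμ_L : 0 < μ_L := hshape_L
  have hl : 0 < l_c := pathLoss_pos hC₀ hd₀ hd
  have hG : 0 < G := mul_pos hGt hGr
  have hρ : 0 < ρ := by positivity
  have hK : 0 < ∏ i ∈ Finset.Icc 1 L, (N i : ℝ) :=
    Finset.prod_pos fun i hi => by exact_mod_cast hN i hi
  have hA : 0 < ρ * (∏ i ∈ Finset.Icc 1 L, (N i : ℝ)) ^ 2 := by positivity
  -- Brings the argument into the form produced by the moments: the coefficient `A` of `Z₁² Z_L²`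
  -- times the two ratios of spread to shape.
  have hz : z = ρ * (∏ i ∈ Finset.Icc 1 L, (N i : ℝ)) ^ 2 * (ω₁ / μ₁ * (ω_L / μ_L)) := by
    simp only [z, ρ, Finset.prod_pow]
    field_simp
  have hzpos : 0 < z := by
    rw [hz]
    positivity
  have hpdf : HasPDF H P volume := hasPDF_mul_of_hasLaw_nakagami hZ₁ hZ_L hindep hK.ne'
  have hpos : ∀ᵐ s ∂P, 0 < H s := by
    filter_upwards [ae_pos_of_hasLaw_nakagami hZ₁, ae_pos_of_hasLaw_nakagami hZ_L] with s p₁ p₂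
    exact mul_pos (mul_pos hK p₁) p₂
  have hsq : ∀ s, 1 + ρ * H s ^ 2 =
      1 + ρ * (∏ i ∈ Finset.Icc 1 L, (N i : ℝ)) ^ 2 * (Z₁ s ^ 2 * Z_L s ^ 2) := by
    intro s
    simp only [H, channelAmplitude]
    ring
  refine ⟨hpdf, integrableOn_capacity_integrand ?_,
    meijerGConverges_logMoment hμ₁ hμ_L hzpos, ?_⟩
  · simp only [hsq]
    exact integrable_log_one_add_mul_sq hμ₁ hω₁ hμ_L hω_L hZ₁ hZ_L hindep hA.le
  · rw [ergodicCapacity_eq hpos, Complex.ofReal_div]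
    simp only [hsq]
    rw [integral_log_one_add_mul_sq_eq_meijerG hμ₁ hω₁ hμ_L hω_L hZ₁ hZ_L hindep hA, hz]
    push_cast
    ring
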